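/- For a measurable function $f$ on the real line, write $$\mathcal{M}P f(\rho)=\sup_{0<\theta<\pi}\left|\frac1\pi\int_{D}\frac{\rho\sin\theta}{(t-\rho\cos\theta)^2+(\rho\sin\theta)^2}\,f(t)\,dt\right|,\qquad \rho>0,$$ where the domain of integration $D$ is either $\mathbb{R}$ or $\mathbb{R}_+=(0,\infty)$. This is the angular maximal Poisson transform of $f$: the supremum over the half-circle $|z|=\rho$, $\operatorname{Im} z>0$, of the modulus of the Poisson transform $\frac1\pi\int_{D}\frac{y}{(t-x)^2+y^2}f(t)\,dt$, $z=x+iy$. Theorem 2. Let $1<p\le\infty$. There is a finite constant $K_2$, depending only on $p$, such that for $D=\mathbb{R}$ and for $D=\mathbb{R}_+$ and for every complex-valued $f\in L^p(D)$ the Poisson integrals converge absolutely at all points $z$ of the upper half-plane, the function $\mathcal{M}P f$ belongs to $L^p(\mathbb{R}_+)$, and $$\|\mathcal{M}P f\|_{L^p(\mathbb{R}_+)}\le K_2\,\|f\|_{L^p(D)}.$$ -/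

import Mathlib

open MeasureTheory Set
open scoped ENNReal NNReal

noncomputable section

/-- The Poisson transform, at the point `z = x + i y` of the upper half-plane, of a
function `f` on the set `D` (the real line `univ` or the half-line `Ioi 0`):
`(1 / π) ∫_D y / ((t - x)^2 + y^2) f(t) dt`. -/
def poissonTransform (D : Set ℝ) (f : ℝ → ℂ) (z : ℂ) : ℂ :=
  (1 / Real.pi : ℝ) • ∫ t in D, (z.im / ((t - z.re) ^ 2 + z.im ^ 2)) • f t

/-- The angular maximal function of `g` for the sector `θ₁ < arg z < θ₂`:
`ρ ↦ sup_{θ₁ < θ < θ₂} |g (ρ e^{iθ})|`, with values in `[0, ∞]`. -/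
def angularMaximal (θ₁ θ₂ : ℝ) (g : ℂ → ℂ) (ρ : ℝ) : ℝ≥0∞ :=
  ⨆ θ ∈ Ioo θ₁ θ₂, ‖g ((ρ : ℂ) * Complex.exp ((θ : ℂ) * Complex.I))‖ₑ

/-- The angular maximal Poisson transform, a function of `ρ > 0`: the angular maximal
function of the Poisson transform for the upper half-plane. -/
def angularMaximalPoisson (D : Set ℝ) (f : ℝ → ℂ) : ℝ → ℝ≥0∞ :=
  angularMaximal 0 Real.pi (poissonTransform D f)

end

/-! The half-circle of radius `ρ` lies in the two cones `|x - a| ≤ y` with vertices `a = ρ` and `a =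
-ρ`. In such a cone the Poisson kernel at `x + iy` is at most three times the kernel at `a + iy`
(`enorm_poissonTransform_le_hlMaximal`). The latter is symmetric about `a`, decreasing away from it
and of mass one, hence a mixture of averages over balls centred at `a`
(`lintegral_mul_cauchyPDF_le_hlMaximal`). So the angular maximal function at `ρ` is at most three
times the sum of the Hardy-Littlewood maximal function at `±ρ`, and the `L^p` bound is
`exists_eLpNorm_hlMaximal_le`, obtained from a Vitali covering and the layer-cake formula. -/

/-! ### The Hardy-Littlewood maximal inequality -/

/-- The uncentred Hardy-Littlewood maximal function on the real line. -/
noncomputable def hlMaximal (F : ℝ → ℝ≥0∞) (x : ℝ) : ℝ≥0∞ :=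
  ⨆ q : ℝ × ℝ, (Metric.ball q.1 q.2).indicator
    (fun _ => (∫⁻ t in Metric.ball q.1 q.2, F t) / ENNReal.ofReal (2 * q.2)) x

theorem measurable_hlMaximal (F : ℝ → ℝ≥0∞) : Measurable (hlMaximal F) :=
  (lowerSemicontinuous_iSup fun _ =>
    Metric.isOpen_ball.lowerSemicontinuous_indicator zero_le).measurable

theorem lt_hlMaximal_iff {F : ℝ → ℝ≥0∞} {x : ℝ} {l : ℝ≥0∞} :
    l < hlMaximal F x ↔ ∃ c r : ℝ, x ∈ Metric.ball c r ∧
      l < (∫⁻ t in Metric.ball c r, F t) / ENNReal.ofReal (2 * r) := by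
  simp only [hlMaximal, lt_iSup_iff, Prod.exists]
  refine exists_congr fun c => exists_congr fun r => ?_
  by_cases h : x ∈ Metric.ball c r <;> simp [h, -Metric.mem_ball]

theorem setLIntegral_ball_le_hlMaximal (F : ℝ → ℝ≥0∞) (x r : ℝ) :
    ∫⁻ t in Metric.ball x r, F t ≤ hlMaximal F x * volume (Metric.ball x r) := by
  rcases le_or_gt r 0 with hr | hr
  · simp [Metric.ball_eq_empty.2 hr]
  · rw [Real.volume_ball, ← ENNReal.div_le_iff (by simpa using hr) ENNReal.ofReal_ne_top]
    refine le_trans ?_ (le_iSup _ (x, r))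
    simp [hr]

/-- The weak type (1,1) covering estimate. -/
theorem measure_iUnion_ball_le (G : ℝ → ℝ≥0∞) {l : ℝ≥0∞} (hl : l ≠ 0) (hl' : l ≠ ∞) {S : Set ℝ}
    (hS : ∀ x ∈ S, ∃ c r : ℝ, x ∈ Metric.ball c r ∧
      l * ENNReal.ofReal r ≤ ∫⁻ t in Metric.ball c r, G t) :
    volume S ≤ 10 / l * ∫⁻ t, G t := by
  by_cases hG : ∫⁻ t, G t = ∞
  · rw [hG, ENNReal.mul_top (by simp [hl'])]
    exact le_top
  let T : Set (ℝ × ℝ) := {q | 0 < q.2 ∧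
    l * ENNReal.ofReal q.2 ≤ ∫⁻ t in Metric.ball q.1 q.2, G t}
  -- Vitali's lemma needs bounded radii; finiteness of `∫⁻ t, G t` supplies the bound.
  have hT : ∀ q ∈ T, q.2 ≤ ((∫⁻ t, G t) / l).toReal := by
    rintro q ⟨hq, hq'⟩
    rw [← ENNReal.ofReal_le_iff_le_toReal (ENNReal.div_ne_top hG hl),
      ENNReal.le_div_iff_mul_le (.inl hl) (.inl hl'), mul_comm]
    exact hq'.trans (setLIntegral_le_lintegral _ _)
  obtain ⟨u, huT, hdisj, hcov⟩ := Vitali.exists_disjoint_subfamily_covering_enlargement_closedBall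
    T (fun q => q.1) (fun q => q.2) _ hT 5 (by norm_num)
  have hu : u.Countable := hdisj.countable_of_nonempty_interior fun q hq => by
    refine ⟨q.1, ?_⟩
    exact Metric.ball_subset_interior_closedBall (Metric.mem_ball_self (huT hq).1)
  have hdisj' : u.PairwiseDisjoint fun q => Metric.ball q.1 q.2 :=
    hdisj.mono fun q => Metric.ball_subset_closedBall
  have hsub : S ⊆ ⋃ q ∈ u, Metric.closedBall q.1 (5 * q.2) := by
    intro x hx
    obtain ⟨c, r, hxr, hlr⟩ := hS x hx
    obtain ⟨b, hb, hsub⟩ := hcov (c, r) ⟨Metric.pos_of_mem_ball hxr, hlr⟩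
    exact mem_biUnion hb (hsub (Metric.ball_subset_closedBall hxr))
  calc volume S ≤ ∑' q : u, volume (Metric.closedBall q.1.1 (5 * q.1.2)) :=
        (measure_mono hsub).trans (measure_biUnion_le _ hu _)
    _ ≤ ∑' q : u, 10 / l * ∫⁻ t in Metric.ball q.1.1 q.1.2, G t := by
        refine ENNReal.tsum_le_tsum fun q => ?_
        rw [Real.volume_closedBall, show 2 * (5 * q.1.2) = 10 * q.1.2 by ring,
          ENNReal.ofReal_mul (by norm_num), ENNReal.ofReal_ofNat]
        calc 10 * ENNReal.ofReal q.1.2 = 10 / l * (l * ENNReal.ofReal q.1.2) := by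
              rw [← mul_assoc, ENNReal.div_mul_cancel hl hl']
          _ ≤ _ := by gcongr; exact (huT q.2).2
    _ = 10 / l * ∫⁻ t in ⋃ q ∈ u, Metric.ball q.1 q.2, G t := by
        rw [ENNReal.tsum_mul_left,
          lintegral_biUnion hu (fun _ _ => Metric.isOpen_ball.measurableSet) hdisj']
    _ ≤ _ := by gcongr; exact Measure.restrict_le_self

/-- Values of `g` up to `s / 2` contribute at most `s * r` to the integral over a ball of length `2
* r`, so the large values must account for the other half of `2 * r * s`. -/
theorem measure_lt_hlMaximal_le {g : ℝ → ℝ} (hg : Measurable g) {s : ℝ} (hs : 0 < s) :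
    volume {x | ENNReal.ofReal s < hlMaximal (fun t => ENNReal.ofReal (g t)) x} ≤
      10 / ENNReal.ofReal s * ∫⁻ t in {t | s < 2 * g t}, ENNReal.ofReal (g t) := by
  have hm : MeasurableSet {t | s < 2 * g t} := measurableSet_lt measurable_const (hg.const_mul 2)
  rw [← lintegral_indicator hm]
  refine measure_iUnion_ball_le _ (by simpa using hs) ENNReal.ofReal_ne_top fun x hx => ?_
  obtain ⟨c, r, hxr, hlt⟩ := lt_hlMaximal_iff.1 hx
  have hr := Metric.pos_of_mem_ball hxr
  refine ⟨c, r, hxr, ?_⟩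
  rw [ENNReal.lt_div_iff_mul_lt (.inl (by simpa using hr)) (.inl ENNReal.ofReal_ne_top)] at hlt
  have hle : ∫⁻ t in Metric.ball c r, ENNReal.ofReal (g t) ≤
      (∫⁻ t in Metric.ball c r, {t | s < 2 * g t}.indicator (fun t => ENNReal.ofReal (g t)) t) +
        ENNReal.ofReal s * ENNReal.ofReal r := by
    calc _ ≤ ∫⁻ t in Metric.ball c r, ({t | s < 2 * g t}.indicator
            (fun t => ENNReal.ofReal (g t)) t + ENNReal.ofReal (s / 2)) := by
          refine lintegral_mono fun t => ?_
          by_cases ht : s < 2 * g t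
          · simp [ht]
          · simp only [mem_ofPred_eq, ht, not_false_eq_true, indicator_of_notMem, zero_add]
            exact ENNReal.ofReal_le_ofReal (by linarith)
      _ = _ := by
          rw [lintegral_add_right _ measurable_const, setLIntegral_const, Real.volume_ball,
            ← ENNReal.ofReal_mul (by positivity), ← ENNReal.ofReal_mul (by positivity)]
          congr 2; ring
  rw [two_mul, ENNReal.ofReal_add hr.le hr.le, mul_add] at hlt
  exact (ENNReal.add_le_add_iff_right
    (ENNReal.mul_ne_top ENNReal.ofReal_ne_top ENNReal.ofReal_ne_top)).1 (hlt.le.trans hle)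

/-- The strong type estimate for the truncated maximal function. -/
theorem lintegral_truncated_hlMaximal_rpow_le {g : ℝ → ℝ} (hg : Measurable g) (hg0 : 0 ≤ g)
    {p : ℝ} (hp : 1 < p) (N : ℕ) :
    ∫⁻ x, (min (hlMaximal (fun t => ENNReal.ofReal (g t)) x) N) ^ p ≤
      ENNReal.ofReal (10 * p / (p - 1) * 2 ^ (p - 1)) * ∫⁻ t, ENNReal.ofReal (g t) ^ p := by
  set M := hlMaximal (fun t => ENNReal.ofReal (g t)) with hM
  have hMm : Measurable M := measurable_hlMaximal _
  set ν := volume.withDensity fun t => ENNReal.ofReal (g t)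
  -- The truncation keeps values finite, as the real-valued layer-cake formula requires.
  have htop : ∀ x, min (M x) N ≠ ∞ := fun x =>
    ((min_le_right _ _).trans_lt (ENNReal.natCast_lt_top N)).ne
  have hp1 : 0 < p - 1 := by linarith
  calc ∫⁻ x, (min (M x) N) ^ p
      = ∫⁻ x, ENNReal.ofReal ((min (M x) N).toReal ^ p) := by
        refine lintegral_congr fun x => ?_
        rw [← ENNReal.ofReal_rpow_of_nonneg ENNReal.toReal_nonneg (by linarith),
          ENNReal.ofReal_toReal (htop x)]
    _ = ENNReal.ofReal p * ∫⁻ s in Ioi 0, volume {x | s < (min (M x) N).toReal} *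
          ENNReal.ofReal (s ^ (p - 1)) :=
        lintegral_rpow_eq_lintegral_meas_lt_mul volume
          (Filter.Eventually.of_forall fun x => ENNReal.toReal_nonneg)
          (hMm.min measurable_const).ennreal_toReal.aemeasurable (by linarith)
    _ ≤ ENNReal.ofReal p * ∫⁻ s in Ioi 0, 10 * (ν {t | s < 2 * g t} *
          ENNReal.ofReal (s ^ (p - 1 - 1))) := by
        gcongr ENNReal.ofReal p * ?_
        refine setLIntegral_mono' measurableSet_Ioi fun s (hs : 0 < s) => ?_
        have h1 : volume {x | s < (min (M x) N).toReal} ≤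
            10 / ENNReal.ofReal s * ν {t | s < 2 * g t} := by
          rw [withDensity_apply _ (measurableSet_lt measurable_const (hg.const_mul 2))]
          refine (measure_mono fun x hx => ?_).trans (measure_lt_hlMaximal_le hg hs)
          exact lt_of_lt_of_le ((ENNReal.ofReal_lt_iff_lt_toReal hs.le (htop x)).2 hx)
            (min_le_left _ _)
        calc _ ≤ 10 / ENNReal.ofReal s * ν {t | s < 2 * g t} * ENNReal.ofReal (s ^ (p - 1)) := by
              gcongr
          _ = 10 / ENNReal.ofReal s * ν {t | s < 2 * g t} *
                (ENNReal.ofReal s * ENNReal.ofReal (s ^ (p - 1 - 1))) := by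
              rw [← ENNReal.ofReal_mul hs.le, Real.rpow_sub_one hs.ne' (p - 1),
                mul_div_cancel₀ _ hs.ne']
          _ = (10 / ENNReal.ofReal s * ENNReal.ofReal s) * (ν {t | s < 2 * g t} *
                ENNReal.ofReal (s ^ (p - 1 - 1))) := by ring
          _ = _ := by rw [ENNReal.div_mul_cancel (by simpa using hs) ENNReal.ofReal_ne_top]
    -- Layer cake read backwards, for `2 * g` under `g dt` with exponent `p - 1`.
    _ = ENNReal.ofReal (10 * p / (p - 1)) * ∫⁻ t, ENNReal.ofReal ((2 * g t) ^ (p - 1)) ∂ν := by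
        rw [lintegral_const_mul' _ _ (by simp), lintegral_rpow_eq_lintegral_meas_lt_mul ν
          (Filter.Eventually.of_forall fun t => mul_nonneg zero_le_two (hg0 t))
          (hg.const_mul 2).aemeasurable hp1, ← mul_assoc, ← mul_assoc,
          ← ENNReal.ofReal_mul (by positivity), div_mul_cancel₀ _ hp1.ne', mul_comm 10 p,
          ENNReal.ofReal_mul (by linarith), ENNReal.ofReal_ofNat]
    _ = _ := by
        rw [lintegral_withDensity_eq_lintegral_mul _ hg.ennreal_ofReal (by fun_prop),
          ENNReal.ofReal_mul (by positivity), mul_assoc,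
          ← lintegral_const_mul' (ENNReal.ofReal (2 ^ (p - 1))) _ ENNReal.ofReal_ne_top]
        congr 1
        refine lintegral_congr fun t => ?_
        simp only [Pi.mul_apply]
        rw [ENNReal.ofReal_rpow_of_nonneg (hg0 t) (by linarith), ← ENNReal.ofReal_mul (hg0 t),
          ← ENNReal.ofReal_mul (by positivity), Real.mul_rpow zero_le_two (hg0 t)]
        congr 1
        have : g t * g t ^ (p - 1) = g t ^ p := by
          rw [mul_comm, ← Real.rpow_add_one' (hg0 t) (by linarith), sub_add_cancel]
        rw [← this]; ring

theorem lintegral_hlMaximal_rpow_le {g : ℝ → ℝ} (hg : Measurable g) (hg0 : 0 ≤ g)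
    {p : ℝ} (hp : 1 < p) :
    ∫⁻ x, hlMaximal (fun t => ENNReal.ofReal (g t)) x ^ p ≤
      ENNReal.ofReal (10 * p / (p - 1) * 2 ^ (p - 1)) * ∫⁻ t, ENNReal.ofReal (g t) ^ p := by
  set M := hlMaximal (fun t => ENNReal.ofReal (g t)) with hM
  have hMm : Measurable M := measurable_hlMaximal _
  have hp0 : 0 < p := by linarith
  have hsup : ∀ x, M x ^ p = ⨆ N : ℕ, (min (M x) N) ^ p := fun x => by
    have h : ⨆ N : ℕ, min (M x) (N : ℝ≥0∞) = M x := by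
      rw [← inf_iSup_eq, ENNReal.iSup_natCast, inf_top_eq]
    conv_lhs => rw [← h]
    exact (ENNReal.orderIsoRpow p hp0).map_iSup _
  simp_rw [hsup]
  rw [lintegral_iSup (fun N => (hMm.min measurable_const).pow_const p)]
  · exact iSup_le fun N => lintegral_truncated_hlMaximal_rpow_le hg hg0 hp N
  · intro m n hmn x
    dsimp only
    gcongr

theorem hlMaximal_le_eLpNorm_top (F : ℝ → ℝ≥0∞) (x : ℝ) :
    hlMaximal F x ≤ eLpNorm F ∞ volume := by
  refine le_of_forall_lt fun l hl => ?_
  obtain ⟨c, r, hxr, hlt⟩ := lt_hlMaximal_iff.1 hl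
  have hr := Metric.pos_of_mem_ball hxr
  refine hlt.trans_le (ENNReal.div_le_of_le_mul ?_)
  rw [← Real.volume_ball c r, ← setLIntegral_const]
  refine lintegral_mono_ae (ae_restrict_of_ae ?_)
  simpa [eLpNorm_exponent_top, eLpNormEssSup] using ae_le_essSup (f := F)

/-- The **Hardy-Littlewood maximal inequality** on the real line. -/
theorem exists_eLpNorm_hlMaximal_le {p : ℝ≥0∞} (hp : 1 < p) :
    ∃ C : ℝ≥0, ∀ g : ℝ → ℝ, Measurable g → 0 ≤ g →
      eLpNorm (hlMaximal (fun t => ENNReal.ofReal (g t))) p volume ≤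
        C * eLpNorm (fun t => ENNReal.ofReal (g t)) p volume := by
  rcases eq_or_ne p ∞ with rfl | hp'
  · refine ⟨1, fun g _ _ => ?_⟩
    rw [ENNReal.coe_one, one_mul]
    conv_lhs => rw [eLpNorm_exponent_top]
    refine essSup_le_of_ae_le _ (Filter.Eventually.of_forall fun x => ?_)
    simpa using hlMaximal_le_eLpNorm_top _ x
  · have hq : 1 < p.toReal := by
      simpa using (ENNReal.toReal_lt_toReal ENNReal.one_ne_top hp').2 hp
    have hq0 : 0 < p.toReal := by linarith
    set q := p.toReal with hqdef
    refine ⟨(ENNReal.ofReal (10 * q / (q - 1) * 2 ^ (q - 1)) ^ (1 / q)).toNNReal,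
      fun g hg hg0 => ?_⟩
    rw [ENNReal.coe_toNNReal (ENNReal.rpow_ne_top_of_nonneg (by positivity) ENNReal.ofReal_ne_top),
      eLpNorm_eq_lintegral_rpow_enorm_toReal (by positivity) hp',
      eLpNorm_eq_lintegral_rpow_enorm_toReal (by positivity) hp',
      ← ENNReal.mul_rpow_of_nonneg _ _ (by positivity)]
    gcongr
    simpa using lintegral_hlMaximal_rpow_le hg hg0 hq

/-! ### Domination of the Poisson transform by the maximal function -/

theorem lintegral_mul_cauchyPDF_le_hlMaximal {F : ℝ → ℝ≥0∞} (hF : Measurable F) (a : ℝ)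
    {γ : ℝ≥0} (hγ : γ ≠ 0) :
    ∫⁻ t, F t * ProbabilityTheory.cauchyPDF a γ t ≤ hlMaximal F a := by
  rcases eq_or_ne (hlMaximal F a) ∞ with hM | hM
  · simp [hM]
  set c := ProbabilityTheory.cauchyPDFReal a γ with hc
  have hcm : Measurable c := ProbabilityTheory.measurable_cauchyPDFReal a γ
  have hc0 : 0 ≤ c := fun t => (ProbabilityTheory.cauchyPDF_pos a hγ t).le
  -- For large `s` the radicand is negative, `Real.sqrt` returns 0 and the ball is empty, as it
  -- should be.
  have hball : ∀ s > 0, {t | s < c t} =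
      Metric.ball a (Real.sqrt (Real.pi⁻¹ * γ / s - γ ^ 2)) := fun s hs => by
    ext t
    have hγ0 : (0 : ℝ) < γ := by positivity
    simp only [mem_ofPred_eq, Metric.mem_ball, Real.dist_eq, hc,
      ProbabilityTheory.cauchyPDFReal_def]
    rw [Real.lt_sqrt (abs_nonneg _), sq_abs, ← div_eq_mul_inv, lt_div_iff₀ (by positivity),
      lt_sub_iff_add_lt, lt_div_iff₀ hs, mul_comm]
  calc ∫⁻ t, F t * ProbabilityTheory.cauchyPDF a γ t
      = ∫⁻ t, ENNReal.ofReal (c t) ∂(volume.withDensity F) := by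
        rw [lintegral_withDensity_eq_lintegral_mul _ hF hcm.ennreal_ofReal]
        rfl
    _ = ∫⁻ s in Ioi 0, volume.withDensity F {t | s < c t} :=
        lintegral_eq_lintegral_meas_lt _ (Filter.Eventually.of_forall hc0) hcm.aemeasurable
    _ ≤ ∫⁻ s in Ioi 0, hlMaximal F a * volume {t | s < c t} := by
        refine setLIntegral_mono' measurableSet_Ioi fun s hs => ?_
        rw [hball s hs, withDensity_apply _ Metric.isOpen_ball.measurableSet]
        exact setLIntegral_ball_le_hlMaximal F a _
    _ = hlMaximal F a * ∫⁻ t, ENNReal.ofReal (c t) := by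
        rw [lintegral_const_mul' _ _ hM, lintegral_eq_lintegral_meas_lt _
          (Filter.Eventually.of_forall hc0) hcm.aemeasurable]
    _ = hlMaximal F a := by
        rw [show ∫⁻ t, ENNReal.ofReal (c t) = 1 from
          ProbabilityTheory.lintegral_cauchyPDF_eq_one a hγ, mul_one]

theorem enorm_poissonTransform_le_hlMaximal {f : ℝ → ℂ} (hf : StronglyMeasurable f) {z : ℂ}
    (hz : 0 < z.im) {a : ℝ} (ha : |z.re - a| ≤ z.im) :
    ‖poissonTransform univ f z‖ₑ ≤ 3 * hlMaximal (fun t => ENNReal.ofReal ‖f t‖) a := by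
  have hγ : z.im.toNNReal ≠ 0 := by simpa using hz
  calc ‖poissonTransform univ f z‖ₑ
      = ‖∫ t, (1 / Real.pi : ℝ) • ((z.im / ((t - z.re) ^ 2 + z.im ^ 2)) • f t)‖ₑ := by
        rw [poissonTransform, Measure.restrict_univ, integral_smul]
    _ ≤ ∫⁻ t, ‖(1 / Real.pi : ℝ) • ((z.im / ((t - z.re) ^ 2 + z.im ^ 2)) • f t)‖ₑ :=
        enorm_integral_le_lintegral_enorm _
    _ ≤ ∫⁻ t, 3 * (ENNReal.ofReal ‖f t‖ *
          ProbabilityTheory.cauchyPDF a z.im.toNNReal t) := by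
        refine lintegral_mono fun t => ?_
        rw [ProbabilityTheory.cauchyPDF, ← ENNReal.ofReal_mul (norm_nonneg _),
          show (3 : ℝ≥0∞) = ENNReal.ofReal 3 by simp, ← ENNReal.ofReal_mul (by norm_num),
          ← ofReal_norm]
        refine ENNReal.ofReal_le_ofReal ?_
        rw [norm_smul, norm_smul, ProbabilityTheory.cauchyPDFReal_def,
          Real.coe_toNNReal _ hz.le, Real.norm_of_nonneg (by positivity),
          Real.norm_of_nonneg (by positivity)]
        have hsq : (z.re - a) ^ 2 ≤ z.im ^ 2 := sq_le_sq' (by linarith [neg_le_of_abs_le ha])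
          (le_of_abs_le ha)
        have hk : z.im / ((t - z.re) ^ 2 + z.im ^ 2) ≤
            3 * (z.im * ((t - a) ^ 2 + z.im ^ 2)⁻¹) := by
          rw [← div_eq_mul_inv, ← mul_div_assoc, div_le_div_iff₀ (by positivity) (by positivity)]
          -- From `(t - a)² ≤ 2 (t - x)² + 2 (x - a)²` and `|x - a| ≤ y`.
          have : (t - a) ^ 2 + z.im ^ 2 ≤ 3 * ((t - z.re) ^ 2 + z.im ^ 2) := by
            nlinarith [sq_nonneg (t - z.re - (z.re - a)), sq_nonneg (t - z.re)]
          calc _ ≤ z.im * (3 * ((t - z.re) ^ 2 + z.im ^ 2)) := by gcongr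
            _ = _ := by ring
        calc _ ≤ 1 / Real.pi * (3 * (z.im * ((t - a) ^ 2 + z.im ^ 2)⁻¹) * ‖f t‖) := by gcongr
          _ = _ := by rw [one_div]; ring
    _ ≤ _ := by
        rw [lintegral_const_mul' _ _ (by simp)]
        gcongr
        exact lintegral_mul_cauchyPDF_le_hlMaximal hf.measurable.norm.ennreal_ofReal a hγ

theorem angularMaximalPoisson_le_hlMaximal {f : ℝ → ℂ} (hf : StronglyMeasurable f) {ρ : ℝ}
    (hρ : 0 < ρ) :
    angularMaximalPoisson univ f ρ ≤ 3 * (hlMaximal (fun t => ENNReal.ofReal ‖f t‖) ρ +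
      hlMaximal (fun t => ENNReal.ofReal ‖f t‖) (-ρ)) := by
  refine iSup₂_le fun θ hθ => ?_
  have hs : 0 < Real.sin θ := Real.sin_pos_of_pos_of_lt_pi hθ.1 hθ.2
  have hre : ((ρ : ℂ) * Complex.exp ((θ : ℂ) * Complex.I)).re = ρ * Real.cos θ := by
    rw [Complex.re_ofReal_mul, Complex.exp_ofReal_mul_I_re]
  have him : ((ρ : ℂ) * Complex.exp ((θ : ℂ) * Complex.I)).im = ρ * Real.sin θ := by
    rw [Complex.im_ofReal_mul, Complex.exp_ofReal_mul_I_im]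
  have hpos : 0 < ((ρ : ℂ) * Complex.exp ((θ : ℂ) * Complex.I)).im := by
    rw [him]; positivity
  have hsc := Real.sin_sq_add_cos_sq θ
  have hc1 := Real.cos_le_one θ
  have hc2 := Real.neg_one_le_cos θ
  rw [mul_add]
  rcases le_total 0 (Real.cos θ) with hc | hc
  · refine le_add_right (enorm_poissonTransform_le_hlMaximal hf hpos ?_)
    -- `1 - cos θ ≤ 1 - cos² θ = sin² θ ≤ sin θ`.
    have : 1 - Real.cos θ ≤ Real.sin θ := by nlinarith [Real.sin_le_one θ]
    rw [hre, him, abs_sub_comm, abs_of_nonneg (by nlinarith)]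
    nlinarith
  · refine le_add_left (enorm_poissonTransform_le_hlMaximal hf hpos ?_)
    have : 1 + Real.cos θ ≤ Real.sin θ := by nlinarith [Real.sin_le_one θ]
    rw [hre, him, abs_of_nonneg (by nlinarith)]
    nlinarith

theorem exists_eLpNorm_angularMaximalPoisson_le {p : ℝ≥0∞} (hp : 1 < p) :
    ∃ K : ℝ≥0, ∀ f : ℝ → ℂ, StronglyMeasurable f →
      eLpNorm (angularMaximalPoisson univ f) p (volume.restrict (Ioi 0)) ≤
        K * eLpNorm f p volume := by
  obtain ⟨C, hC⟩ := exists_eLpNorm_hlMaximal_le hp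
  refine ⟨6 * C, fun f hf => ?_⟩
  obtain ⟨M, hMdef⟩ : ∃ M, M = hlMaximal (fun t => ENNReal.ofReal ‖f t‖) := ⟨_, rfl⟩
  have hM : Measurable M := hMdef ▸ measurable_hlMaximal _
  have hCM : eLpNorm M p volume ≤ C * eLpNorm f p volume := by
    have h := hC (fun t => ‖f t‖) hf.measurable.norm fun _ => norm_nonneg _
    rwa [← hMdef, eLpNorm_congr_enorm_ae (f := fun t => ENNReal.ofReal ‖f t‖) (g := f)
      (Filter.Eventually.of_forall fun t => by simp)] at h
  have hneg : eLpNorm (fun x => M (-x)) p volume = eLpNorm M p volume :=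
    eLpNorm_comp_measurePreserving (f := fun x : ℝ => -x) hM.aestronglyMeasurable
      (Measure.measurePreserving_neg volume)
  calc eLpNorm (angularMaximalPoisson univ f) p (volume.restrict (Ioi 0))
      ≤ (3 : ℝ≥0) * eLpNorm (M + fun x => M (-x)) p (volume.restrict (Ioi 0)) := by
        refine eLpNorm_le_nnreal_smul_eLpNorm_of_ae_le_mul' ?_ p
        filter_upwards [ae_restrict_mem measurableSet_Ioi] with ρ hρ
        simpa [hMdef] using angularMaximalPoisson_le_hlMaximal hf hρ
    _ ≤ (3 : ℝ≥0) * eLpNorm (M + fun x => M (-x)) p volume := by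
        gcongr
        exact Measure.restrict_le_self
    _ ≤ (3 : ℝ≥0) * (eLpNorm M p volume + eLpNorm (fun x => M (-x)) p volume) := by
        gcongr
        exact eLpNorm_add_le hM.aestronglyMeasurable
          (hM.comp measurable_neg).aestronglyMeasurable hp.le
    _ ≤ (3 : ℝ≥0) * (C * eLpNorm f p volume + C * eLpNorm f p volume) := by
        rw [hneg]; gcongr
    _ = _ := by push_cast; ring

/-! ### Absolute convergence and measurability -/

/-- For finite `p`, the kernel dominates where `|f| ≤ 1`; elsewhere `|f| ≤ |f|^p` and the kernel is
at most `1 / y`. -/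
theorem integrable_poissonKernel_smul {p : ℝ≥0∞} (hp : 1 ≤ p) {f : ℝ → ℂ}
    (hf : MemLp f p volume) {z : ℂ} (hz : 0 < z.im) :
    Integrable fun t : ℝ => (z.im / ((t - z.re) ^ 2 + z.im ^ 2)) • f t := by
  have hk : Integrable fun t : ℝ => z.im / ((t - z.re) ^ 2 + z.im ^ 2) := by
    refine ((ProbabilityTheory.integrable_cauchyPDFReal z.re (γ := z.im.toNNReal)).const_mul
      Real.pi).congr (Filter.Eventually.of_forall fun t => ?_)
    simp only [ProbabilityTheory.cauchyPDFReal_def, Real.coe_toNNReal _ hz.le]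
    field_simp
  have hm : AEStronglyMeasurable
      (fun t : ℝ => (z.im / ((t - z.re) ^ 2 + z.im ^ 2)) • f t) volume :=
    hk.aestronglyMeasurable.smul hf.1
  rcases eq_or_ne p ∞ with rfl | hp'
  · exact hk.smul_of_top_left hf
  · have hp0 : 0 < p.toReal := ENNReal.toReal_pos (zero_lt_one.trans_le hp).ne' hp'
    have hp1 : 1 ≤ p.toReal := by
      simpa using (ENNReal.toReal_le_toReal ENNReal.one_ne_top hp').2 hp
    have hfp := hf.integrable_norm_rpow (zero_lt_one.trans_le hp).ne' hp'
    refine (hk.add (hfp.const_mul z.im⁻¹)).mono' hm (Filter.Eventually.of_forall fun t => ?_)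
    have hk0 : 0 ≤ z.im / ((t - z.re) ^ 2 + z.im ^ 2) := by positivity
    have hk1 : z.im / ((t - z.re) ^ 2 + z.im ^ 2) ≤ z.im⁻¹ := by
      rw [div_le_iff₀ (by positivity), inv_mul_eq_div, le_div_iff₀ hz]
      nlinarith [sq_nonneg (t - z.re)]
    rw [norm_smul, Real.norm_of_nonneg hk0]
    simp only [Pi.add_apply]
    rcases le_total ‖f t‖ 1 with h | h
    · exact (mul_le_of_le_one_right hk0 h).trans (le_add_of_nonneg_right (by positivity))
    · refine le_add_of_nonneg_of_le hk0 ?_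
      gcongr
      exact Real.self_le_rpow_of_one_le h hp1

theorem continuousOn_poissonTransform {p : ℝ≥0∞} (hp : 1 ≤ p) {f : ℝ → ℂ}
    (hf : MemLp f p volume) : ContinuousOn (poissonTransform univ f) {z | 0 < z.im} := by
  intro z₀ (hz₀ : 0 < z₀.im)
  refine ContinuousAt.continuousWithinAt ?_
  unfold poissonTransform
  simp only [Measure.restrict_univ]
  suffices h : ContinuousAt
      (fun z : ℂ => ∫ t : ℝ, (z.im / ((t - z.re) ^ 2 + z.im ^ 2)) • f t) z₀ from
    Filter.Tendsto.const_smul h (1 / Real.pi : ℝ)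
  have hnear : ∀ᶠ z : ℂ in nhds z₀, z₀.im / 2 < z.im ∧ z.im < 2 * z₀.im ∧
      |z.re - z₀.re| < z₀.im := by
    have hi : ContinuousAt Complex.im z₀ := Complex.continuous_im.continuousAt
    refine (hi.eventually_const_lt (by linarith)).and
      ((hi.eventually_lt_const (by linarith)).and ?_)
    have hc : ContinuousAt (fun z : ℂ => |z.re - z₀.re|) z₀ := by fun_prop
    exact hc.eventually_lt_const (by simpa using hz₀)
  -- Near `z₀` the numerators compare with factor 2 and the denominators with factor 12, since `3
  -- y₀² ≤ 12 y²`; hence 24.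
  refine continuousAt_of_dominated
    (bound := fun t => 24 * ‖(z₀.im / ((t - z₀.re) ^ 2 + z₀.im ^ 2)) • f t‖) ?_ ?_ ?_ ?_
  · filter_upwards [hnear] with z hz
    exact (integrable_poissonKernel_smul hp hf (by linarith : 0 < z.im)).1
  · filter_upwards [hnear] with z ⟨h1, h2, h3⟩
    refine Filter.Eventually.of_forall fun t => ?_
    have hz : 0 < z.im := by linarith
    rw [norm_smul, norm_smul, Real.norm_of_nonneg (by positivity),
      Real.norm_of_nonneg (by positivity), ← mul_assoc]
    gcongr
    have hsq : (z.re - z₀.re) ^ 2 ≤ z₀.im ^ 2 := sq_le_sq' (by linarith [neg_lt_of_abs_lt h3])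
      (le_of_abs_le h3.le)
    have hden : (t - z₀.re) ^ 2 + z₀.im ^ 2 ≤ 12 * ((t - z.re) ^ 2 + z.im ^ 2) := by
      nlinarith [sq_nonneg (t - z.re - (z.re - z₀.re)), sq_nonneg (t - z.re)]
    rw [← mul_div_assoc, div_le_div_iff₀ (by positivity) (by positivity)]
    calc _ ≤ (2 * z₀.im) * (12 * ((t - z.re) ^ 2 + z.im ^ 2)) := by gcongr
      _ = _ := by ring
  · exact (integrable_poissonKernel_smul hp hf hz₀).norm.const_mul 24
  · refine Filter.Eventually.of_forall fun t => ?_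
    have : (t - z₀.re) ^ 2 + z₀.im ^ 2 ≠ 0 := by positivity
    fun_prop (disch := assumption)

/-- The supremum over `θ` is uncountable, but lower semicontinuity in `ρ` survives it. -/
theorem aemeasurable_angularMaximalPoisson {p : ℝ≥0∞} (hp : 1 ≤ p) {f : ℝ → ℂ}
    (hf : MemLp f p volume) :
    AEMeasurable (angularMaximalPoisson univ f) (volume.restrict (Ioi 0)) := by
  refine aemeasurable_restrict_of_measurable_subtype measurableSet_Ioi ?_
  refine LowerSemicontinuous.measurable (lowerSemicontinuous_biSup fun θ hθ => ?_)
  refine Continuous.lowerSemicontinuous (Continuous.enorm ?_)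
  refine (continuousOn_poissonTransform hp hf).comp_continuous (by fun_prop) fun ρ => ?_
  simp only [mem_ofPred_eq, Complex.im_ofReal_mul, Complex.exp_ofReal_mul_I_im]
  exact mul_pos ρ.2 (Real.sin_pos_of_pos_of_lt_pi hθ.1 hθ.2)

/-! ### Reduction to the whole line by zero extension -/

theorem poissonTransform_eq_indicator {D : Set ℝ} (hD : MeasurableSet D) {f g : ℝ → ℂ}
    (hfg : f =ᵐ[volume.restrict D] g) :
    poissonTransform D f = poissonTransform univ (D.indicator g) := by
  funext z
  unfold poissonTransform
  rw [Measure.restrict_univ, ← integral_indicator hD]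
  congr 1
  refine integral_congr_ae ?_
  filter_upwards [(ae_restrict_iff' hD).1 hfg] with t ht
  by_cases htD : t ∈ D <;> simp [htD, ht]

theorem theorem2 (p : ℝ≥0∞) (hp : 1 < p) :
    ∃ K : ℝ≥0, ∀ D : Set ℝ, D = Set.univ ∨ D = Set.Ioi 0 →
      ∀ f : ℝ → ℂ, MemLp f p (volume.restrict D) →
        (∀ z : ℂ, 0 < z.im →
          IntegrableOn (fun t : ℝ => (z.im / ((t - z.re) ^ 2 + z.im ^ 2)) • f t) D volume) ∧
        MemLp (angularMaximalPoisson D f) p (volume.restrict (Set.Ioi 0)) ∧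
        eLpNorm (angularMaximalPoisson D f) p (volume.restrict (Set.Ioi 0)) ≤
          K * eLpNorm f p (volume.restrict D) := by
  obtain ⟨K, hK⟩ := exists_eLpNorm_angularMaximalPoisson_le hp
  refine ⟨K, fun D hD f hf => ?_⟩
  have hDm : MeasurableSet D := by
    rcases hD with rfl | rfl
    exacts [MeasurableSet.univ, measurableSet_Ioi]
  -- The maximal bounds need a strongly measurable function; changing `f` on a null set of `D`
  -- leaves every Poisson integral unchanged.
  have hfg := hf.1.ae_eq_mk
  have hf' := hf.1.stronglyMeasurable_mk
  generalize hf.1.mk f = f' at hfg hf'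
  set g := D.indicator f' with hg
  have hgm : StronglyMeasurable g := hf'.indicator hDm
  have hgf : eLpNorm g p volume = eLpNorm f p (volume.restrict D) := by
    rw [hg, eLpNorm_indicator_eq_eLpNorm_restrict hDm, eLpNorm_congr_ae hfg]
  have hgp : MemLp g p volume := ⟨hgm.aestronglyMeasurable, hgf ▸ hf.2⟩
  have hmax : angularMaximalPoisson D f = angularMaximalPoisson univ g := by
    rw [angularMaximalPoisson, angularMaximalPoisson, poissonTransform_eq_indicator hDm hfg]
  have hle : eLpNorm (angularMaximalPoisson D f) p (volume.restrict (Set.Ioi 0)) ≤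
      K * eLpNorm f p (volume.restrict D) := by
    rw [hmax, ← hgf]
    exact hK g hgm
  refine ⟨fun z hz => ?_, ⟨?_, hle.trans_lt (ENNReal.mul_lt_top ENNReal.coe_lt_top hf.2)⟩, hle⟩
  · refine (integrable_poissonKernel_smul hp.le hgp hz).integrableOn.congr ?_
    filter_upwards [hfg, ae_restrict_mem hDm] with t ht htD
    simp [hg, htD, ht]
  · rw [hmax]
    exact (aemeasurable_angularMaximalPoisson hp.le hgp).aestronglyMeasurable
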